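/- Let $b,d\ge 0$ be integers, let $\mathcal H_{\mathrm b}$ and $\mathcal H_{\mathrm f}$ be complex Hilbert spaces of dimensions $b$ and $d$ (the single-boson and single-fermion spaces), and let $\mathcal F_s(\mathcal H)$ denote the corresponding (symmetric, respectively antisymmetric) Fock space. For $n\in\mathbb N^b$ write $|n|=n_1+\dots+n_b$, $n!=n_1!\cdots n_b!$, and let $|n\rangle$ be the normalized occupation-number basis of $\mathcal F_s(\mathcal H_{\mathrm b})$ belonging to a fixed orthonormal basis of $\mathcal H_{\mathrm b}$. Let $\mathcal F_\psi=\mathcal F_\psi(\mathcal H_{\mathrm b})$ be the Fréchet space of all $|f\rangle\in\mathcal F_s(\mathcal H_{\mathrm b})$ with $\|f\|_k^2=\sum_n k^{2|n|}\,|\langle n|f\rangle|^2<\infty$ for every integer $k\ge 1$, topologized by the norms $\|\cdot\|_k$. It is closed under the boson $\psi$ product, which is given on basis vectors by $|p\rangle\odot|q\rangle=\sqrt{(p+q)!/(p!\,q!)}\;|p+q\rangle$. The creation operator of mode $i$ is $a_i^\dagger|v\rangle=|e_i\rangle\odot|v\rangle$, where $|e_i\rangle$ is the state with one boson, in mode $i$.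 On $\mathcal F_s(\mathcal H_{\mathrm f})=\bigwedge\mathcal H_{\mathrm f}$ the $\psi$ product is the wedge product. On $\mathcal E=\mathcal F_\psi(\mathcal H_{\mathrm b})\otimes\mathcal F_s(\mathcal H_{\mathrm f})$ it is the bilinear product with $(u\otimes x)\odot(v\otimes y)=(u\odot v)\otimes(x\odot y)$. The creator of a state $|u\rangle$ is the linear operator $U|v\rangle=|u\rangle\odot|v\rangle$. Expand $|u\rangle\in\mathcal E$ as $|u\rangle=\sum_{i=0}^{2^d-1}|u_i\rangle\otimes|f_i\rangle$, where $\{|f_i\rangle\}$ is the occupation-number basis of $\mathcal F_s(\mathcal H_{\mathrm f})$ and $|f_0\rangle$ is the fermion vacuum. Theorem (Invertibility). Let $U$ be the creator of an arbitrary state $|u\rangle\in\mathcal E$, and let $U_0$ be the creator on $\mathcal F_\psi$ of the boson state $|u_0\rangle$, so that $|u_0\rangle=U_0|0\rangle$. The following statements are equivalent: (a) the linear map $U:\mathcal E\to\mathcal E$ is invertible (bijective); (b) the linear map $U_0:\mathcal F_\psi\to\mathcal F_\psi$ is invertible (bijective); (c) $|u_0\rangle=U_0|0\rangle$ is a (not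 necessarily normalized) Glauber coherent state, that is, $|u_0\rangle=c\,\exp(\alpha\cdot a^\dagger)|0\rangle$ for some $\alpha\in\mathbb C^b$ and some $c\in\mathbb C\setminus\{0\}$, where $\alpha\cdot a^\dagger=\sum_i\alpha_i a_i^\dagger$ and $\exp(\alpha\cdot a^\dagger)|0\rangle=\sum_{m\ge0}\frac1{m!}(\alpha\cdot a^\dagger)^m|0\rangle$ converges in $\mathcal F_\psi$. -/

import Mathlib

open scoped TensorProduct Nat

noncomputable section

namespace Fock

/-! ## Boson Fock space in the occupation-number basis -/

/-- `n! = n₁! ⋯ n_b!` for a vector `n = (n₁, …, n_b)` of occupation numbers. -/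
def multiFactorial {b : ℕ} (n : Fin b →₀ ℕ) : ℕ := ∏ i, (n i)!

/-- The Hilbert–Fock space of bosons with a `b`-dimensional single-particle space:
square-summable families `c`, where `c n = ⟨n|f⟩` is the component along the normalized ket `|n⟩`
with `n i` bosons in mode `i`. -/
abbrev HilbertFock (b : ℕ) : Type := lp (fun _ : Fin b →₀ ℕ => ℂ) 2

/-- Components of the rescaled vector `|f_k⟩`: `⟨n|f_k⟩ = k ^ |n| ⟨n|f⟩`, `|n| = n₁ + ⋯ + n_b`. -/
def rescale {b : ℕ} (k : ℕ) (f : (Fin b →₀ ℕ) → ℂ) : (Fin b →₀ ℕ) → ℂ :=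
  fun n => (k : ℂ) ^ n.degree * f n

/-- The space `F_ψ` as a space of families of components: the intersection over all `k ≥ 1` of the
Hilbert spaces `H_k = {f : ‖f‖_k = ‖f_k‖ < ∞}`. -/
def psiSubmodule (b : ℕ) : Submodule ℂ ((Fin b →₀ ℕ) → ℂ) where
  carrier := {f | ∀ k : ℕ, 1 ≤ k → Memℓp (rescale k f) 2}
  add_mem' {f g} hf hg k hk := by
    have h : rescale k (f + g) = rescale k f + rescale k g := by
      funext n; simp [rescale, mul_add]
    rw [h]; exact (hf k hk).add (hg k hk)
  zero_mem' k _ := by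
    have h : rescale k (0 : (Fin b →₀ ℕ) → ℂ) = 0 := by
      funext n; simp [rescale]
    rw [h]; exact zero_memℓp
  smul_mem' c f hf k hk := by
    have h : rescale k (c • f) = c • rescale k f := by
      funext n; simp [rescale, mul_left_comm]
    rw [h]; exact (hf k hk).const_smul c

/-- The boson space `F_ψ`. -/
def FPsi (b : ℕ) : Type := psiSubmodule b

namespace FPsi

variable {b : ℕ}

instance : AddCommGroup (FPsi b) := inferInstanceAs (AddCommGroup (psiSubmodule b))
instance : Module ℂ (FPsi b) := inferInstanceAs (Module ℂ (psiSubmodule b))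

/-- The component `⟨n|f⟩`. -/
def comp (f : FPsi b) (n : Fin b →₀ ℕ) : ℂ := f.1 n

theorem ext' {f g : FPsi b} (h : ∀ n, f.comp n = g.comp n) : f = g :=
  Subtype.ext (funext h)

theorem comp_add (f g : FPsi b) (n) : (f + g).comp n = f.comp n + g.comp n := rfl
theorem comp_smul (c : ℂ) (f : FPsi b) (n) : (c • f).comp n = c * f.comp n := rfl

/-- The map `f ↦ f_k` into the Hilbert–Fock space (for `k ≥ 1`); `‖f‖_k = ‖toHilbert k f‖`. -/
def toHilbert (k : ℕ+) (f : FPsi b) : HilbertFock b :=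
  ⟨rescale k f.1, f.2 k k.2⟩

/-- The Fréchet topology of `F_ψ`, defined by the countable family of norms
`‖f‖_k = ‖f_k‖`, `k = 1, 2, 3, …`. -/
instance : TopologicalSpace (FPsi b) :=
  ⨅ k : ℕ+, TopologicalSpace.induced (toHilbert k) inferInstance

/-! ### The ψ product of bosons

On basis kets, `|p⟩ ⊙ |q⟩ = √((p+q)! / (p! q!)) |p+q⟩`. -/

/-- Components of the ψ product. -/
def psiProd (f g : (Fin b →₀ ℕ) → ℂ) : (Fin b →₀ ℕ) → ℂ := fun n =>
  ∑ pq ∈ Finset.HasAntidiagonal.antidiagonal n,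
    ((Real.sqrt ((multiFactorial n : ℝ) /
      ((multiFactorial pq.1 : ℝ) * (multiFactorial pq.2 : ℝ))) : ℝ) : ℂ) * (f pq.1 * g pq.2)

theorem multiFactorial_pos (n : Fin b →₀ ℕ) : 0 < multiFactorial n :=
  Finset.prod_pos fun _ _ => Nat.factorial_pos _

theorem multiFactorial_ratio_le {n : Fin b →₀ ℕ} {pq} (h : pq ∈ Finset.HasAntidiagonal.antidiagonal n) :
    (multiFactorial n : ℝ) / ((multiFactorial pq.1 : ℝ) * (multiFactorial pq.2 : ℝ))
      ≤ 2 ^ n.degree := by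
  rw [Finset.HasAntidiagonal.mem_antidiagonal] at h
  subst h
  obtain ⟨p, q⟩ := pq
  simp only
  rw [div_le_iff₀ (by
    have := multiFactorial_pos p; have := multiFactorial_pos q; positivity)]
  rw [Finsupp.degree_eq_sum, ← Finset.prod_pow_eq_pow_sum]
  unfold multiFactorial
  push_cast
  rw [← Finset.prod_mul_distrib, ← Finset.prod_mul_distrib]
  refine Finset.prod_le_prod (fun i _ => by positivity) (fun i _ => ?_)
  have h1 := Nat.add_choose_mul_factorial_mul_factorial (p i) (q i)
  have h2 := Nat.choose_le_two_pow (p i + q i) (q i)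
  have h3 : (p i + q i)! ≤ 2 ^ (p i + q i) * ((p i)! * (q i)!) := by
    rw [← h1, mul_assoc]
    exact Nat.mul_le_mul_right _ h2
  exact_mod_cast h3

theorem card_antidiagonal_le (n : Fin b →₀ ℕ) :
    ((Finset.HasAntidiagonal.antidiagonal n).card : ℝ) ≤ 2 ^ n.degree := by
  have h1 : (Finset.HasAntidiagonal.antidiagonal n).card ≤ (Finset.Iic n).card := by
    refine Finset.card_le_card_of_injOn Prod.fst (fun pq h => ?_) (fun x hx y hy hxy => ?_)
    · simp only [Finset.mem_coe, Finset.HasAntidiagonal.mem_antidiagonal] at h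
      simp only [Finset.coe_Iic, Set.mem_Iic]
      exact h ▸ le_self_add
    · simp only [Finset.mem_coe, Finset.HasAntidiagonal.mem_antidiagonal] at hx hy
      refine Prod.ext hxy ?_
      rw [← hy, hxy] at hx
      exact add_left_cancel hx
  have h2 : (Finset.Iic n).card ≤ 2 ^ n.degree := by
    rw [Finsupp.card_Iic, Finsupp.degree_apply, ← Finset.prod_pow_eq_pow_sum]
    refine Finset.prod_le_prod (fun _ _ => Nat.zero_le _) (fun i _ => ?_)
    rw [Nat.card_Iic]
    exact Nat.lt_two_pow_self
  exact_mod_cast h1.trans h2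

theorem memℓp_rescale_iff (k : ℕ) (f : (Fin b →₀ ℕ) → ℂ) :
    Memℓp (rescale k f) 2 ↔ Summable fun n => ((k : ℝ) ^ n.degree) ^ 2 * ‖f n‖ ^ 2 := by
  rw [memℓp_gen_iff (by norm_num)]
  simp [rescale, mul_pow]

/-- `F_ψ` is closed under the ψ product. -/
theorem psiProd_mem {f g : (Fin b →₀ ℕ) → ℂ} (hf : f ∈ psiSubmodule b)
    (hg : g ∈ psiSubmodule b) : psiProd f g ∈ psiSubmodule b := by
  intro k hk
  have hf' := (memℓp_rescale_iff _ _).1 (hf (2 * k) (by omega))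
  have hg' := (memℓp_rescale_iff _ _).1 (hg (2 * k) (by omega))
  rw [memℓp_rescale_iff]
  have hfg := Summable.mul_of_nonneg hf' hg'
    (Pi.le_def.2 fun n => mul_nonneg (sq_nonneg _) (sq_nonneg _))
    (Pi.le_def.2 fun n => mul_nonneg (sq_nonneg _) (sq_nonneg _))
  have hs := summable_sum_mul_antidiagonal_of_summable_mul
    (f := fun n => (((2 * k : ℕ) : ℝ) ^ n.degree) ^ 2 * ‖f n‖ ^ 2)
    (g := fun n => (((2 * k : ℕ) : ℝ) ^ n.degree) ^ 2 * ‖g n‖ ^ 2) hfg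
  refine Summable.of_nonneg_of_le (fun n => by positivity) (fun n => ?_) hs
  have h1 : ‖psiProd f g n‖ ^ 2 ≤ (Finset.HasAntidiagonal.antidiagonal n).card *
      ∑ pq ∈ Finset.HasAntidiagonal.antidiagonal n, (2 : ℝ) ^ n.degree * (‖f pq.1‖ ^ 2 * ‖g pq.2‖ ^ 2) := by
    refine (pow_le_pow_left₀ (norm_nonneg _) (norm_sum_le _ _) 2).trans ?_
    refine sq_sum_le_card_mul_sum_sq.trans ?_
    refine mul_le_mul_of_nonneg_left (Finset.sum_le_sum fun pq h => ?_) (Nat.cast_nonneg _)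
    rw [norm_mul, norm_mul, Complex.norm_real, mul_pow, mul_pow, Real.norm_eq_abs, sq_abs,
      Real.sq_sqrt (by positivity)]
    exact mul_le_mul_of_nonneg_right (multiFactorial_ratio_le h) (by positivity)
  have h2 : ((k : ℝ) ^ n.degree) ^ 2 * ‖psiProd f g n‖ ^ 2 ≤ ((k : ℝ) ^ n.degree) ^ 2 *
      (2 ^ n.degree *
      ∑ pq ∈ Finset.HasAntidiagonal.antidiagonal n, (2 : ℝ) ^ n.degree * (‖f pq.1‖ ^ 2 * ‖g pq.2‖ ^ 2)) := by
    refine mul_le_mul_of_nonneg_left (h1.trans ?_) (by positivity)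
    exact mul_le_mul_of_nonneg_right (card_antidiagonal_le n)
      (Finset.sum_nonneg fun _ _ => by positivity)
  refine h2.trans (le_of_eq ?_)
  rw [Finset.mul_sum, Finset.mul_sum]
  refine Finset.sum_congr rfl fun pq h => ?_
  rw [Finset.HasAntidiagonal.mem_antidiagonal] at h
  rw [← h, map_add]
  push_cast
  ring

instance : Mul (FPsi b) := ⟨fun f g => ⟨psiProd f.1 g.1, psiProd_mem f.2 g.2⟩⟩

/-- The basis ket `|n⟩`. -/
def ket (n : Fin b →₀ ℕ) : FPsi b :=
  ⟨Pi.single n 1, fun k _ => by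
    rw [memℓp_rescale_iff]
    refine summable_of_ne_finset_zero (s := {n}) fun m hm => ?_
    simp only [Finset.mem_singleton] at hm
    simp [hm]⟩

/-- The unit of the ψ product is the boson vacuum `|0⟩`. -/
instance : One (FPsi b) := ⟨ket 0⟩

/-! The ring axioms are transported from formal power series along
`|f⟩ ↦ ∑ₙ (⟨n|f⟩ / √n!) zⁿ`. -/

/-- The power series `∑ₙ (⟨n|f⟩ / √n!) zⁿ`. -/
def toSeries (f : FPsi b) : MvPowerSeries (Fin b) ℂ := fun n =>
  f.comp n / ((Real.sqrt (multiFactorial n : ℝ) : ℝ) : ℂ)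

theorem sqrt_ne (n : Fin b →₀ ℕ) : ((Real.sqrt (multiFactorial n : ℝ) : ℝ) : ℂ) ≠ 0 := by
  have := multiFactorial_pos n
  exact_mod_cast (Real.sqrt_pos.2 (by exact_mod_cast this)).ne'

theorem coeff_toSeries (f : FPsi b) (n) : MvPowerSeries.coeff n (toSeries f) =
    f.comp n / ((Real.sqrt (multiFactorial n : ℝ) : ℝ) : ℂ) := rfl

theorem toSeries_injective : Function.Injective (toSeries (b := b)) := fun f g h =>
  ext' fun n => by
    have := congrArg (MvPowerSeries.coeff n) h
    rwa [coeff_toSeries, coeff_toSeries, div_left_inj' (sqrt_ne n)] at this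

theorem toSeries_add (f g : FPsi b) : toSeries (f + g) = toSeries f + toSeries g := by
  ext n; rw [map_add]; simp only [coeff_toSeries, comp_add, add_div]

theorem toSeries_smul (c : ℂ) (f : FPsi b) : toSeries (c • f) = c • toSeries f := by
  ext n
  rw [MvPowerSeries.coeff_smul]
  simp only [coeff_toSeries, comp_smul, mul_div_assoc]

theorem toSeries_zero : toSeries (0 : FPsi b) = 0 := by
  simpa using toSeries_smul 0 (0 : FPsi b)

theorem toSeries_one : toSeries (1 : FPsi b) = 1 := by
  classical
  ext n
  rw [coeff_toSeries, MvPowerSeries.coeff_one]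
  change (Pi.single 0 1 : (Fin b →₀ ℕ) → ℂ) n / _ = _
  rcases eq_or_ne n 0 with rfl | h
  · simp [multiFactorial]
  · simp [h]

theorem toSeries_mul (f g : FPsi b) : toSeries (f * g) = toSeries f * toSeries g := by
  classical
  ext n
  rw [MvPowerSeries.coeff_mul, coeff_toSeries]
  change psiProd f.1 g.1 n / _ = _
  rw [psiProd, Finset.sum_div]
  refine Finset.sum_congr rfl fun pq _ => ?_
  rw [coeff_toSeries, coeff_toSeries]
  have hp := sqrt_ne pq.1
  have hq := sqrt_ne pq.2
  have hn := sqrt_ne n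
  rw [Real.sqrt_div (Nat.cast_nonneg _), Real.sqrt_mul (Nat.cast_nonneg _)]
  push_cast
  simp only [comp]
  field_simp

/-- `F_ψ` with the ψ product is a commutative ring. -/
instance : CommRing (FPsi b) :=
  { (inferInstance : AddCommGroup (FPsi b)) with
    mul := (· * ·)
    one := 1
    mul_assoc := fun f g h => toSeries_injective (by simp only [toSeries_mul, mul_assoc])
    mul_comm := fun f g => toSeries_injective (by simp only [toSeries_mul, mul_comm])
    one_mul := fun f => toSeries_injective (by simp only [toSeries_mul, toSeries_one, one_mul])
    mul_one := fun f => toSeries_injective (by simp only [toSeries_mul, toSeries_one, mul_one])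
    zero_mul := fun f => toSeries_injective (by simp only [toSeries_mul, toSeries_zero, zero_mul])
    mul_zero := fun f => toSeries_injective (by simp only [toSeries_mul, toSeries_zero, mul_zero])
    left_distrib := fun f g h => toSeries_injective (by
      simp only [toSeries_mul, toSeries_add, mul_add])
    right_distrib := fun f g h => toSeries_injective (by
      simp only [toSeries_mul, toSeries_add, add_mul]) }

instance : Algebra ℂ (FPsi b) :=
  Algebra.ofModule
    (fun c f g => toSeries_injective (by
      simp only [toSeries_mul, toSeries_smul, smul_mul_assoc]))
    (fun c f g => toSeries_injective (by
      simp only [toSeries_mul, toSeries_smul, mul_smul_comm]))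

end FPsi

/-! ## Bosons and fermions together -/

/-- The fermion Fock space of the single-fermion space `Hf`. For fermions the ψ product is the
wedge product; the unit `1` is the fermion vacuum. -/
abbrev FermionFock (Hf : Type*) [NormedAddCommGroup Hf] [InnerProductSpace ℂ Hf] :=
  ExteriorAlgebra ℂ Hf

/-- The boson–fermion space `E = F_ψ ⊗ F_s(Hf)`. As a ring it carries the ψ product, which acts in
parallel on the factors: `(u ⊗ x) ⊙ (v ⊗ y) = (u ⊙ v) ⊗ (x ⊙ y)`. -/
abbrev BosonFermion (b : ℕ) (Hf : Type*) [NormedAddCommGroup Hf] [InnerProductSpace ℂ Hf] :=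
  FPsi b ⊗[ℂ] FermionFock Hf

/-- The creator `U` of a state `u`: the linear operator `U v = u ⊙ v` (so that `U |0⟩ = u`). -/
def creator {A : Type*} [Ring A] [Algebra ℂ A] (u : A) : A →ₗ[ℂ] A := LinearMap.mulLeft ℂ u

/-- The boson state `u₀` in the expansion `u = ∑ᵢ uᵢ ⊗ fᵢ`, where `f₀` is the fermion vacuum and
the other `fᵢ` have at least one fermion: `w ⊗ x` is sent to `⟨0|x⟩ w`. -/
def vacuumComponent {b : ℕ} {Hf : Type*} [NormedAddCommGroup Hf] [InnerProductSpace ℂ Hf] :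
    BosonFermion b Hf →ₗ[ℂ] FPsi b :=
  (TensorProduct.rid ℂ (FPsi b)).toLinearMap ∘ₗ
    LinearMap.lTensor (FPsi b)
      (ExteriorAlgebra.algebraMapInv : ExteriorAlgebra ℂ Hf →ₐ[ℂ] ℂ).toLinearMap

/-- The boson creation operator `aᵢ†`: the creator of the single-particle state `i`. -/
def creation {b : ℕ} (i : Fin b) : FPsi b →ₗ[ℂ] FPsi b :=
  creator (FPsi.ket (Finsupp.single i 1))

/-- `α · a† = ∑ᵢ αᵢ aᵢ†`. -/
def linearCreation {b : ℕ} (α : Fin b → ℂ) : Module.End ℂ (FPsi b) := ∑ i, α i • creation i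

/-- `v = exp(α · a†)|0⟩`, the exponential series `∑ₘ (α · a†)ᵐ|0⟩ / m!` converging to `v` in the
Fréchet space `F_ψ`. -/
def IsExpVacuum {b : ℕ} (α : Fin b → ℂ) (v : FPsi b) : Prop :=
  HasSum (fun m : ℕ => ((m ! : ℂ)⁻¹) • (linearCreation α ^ m) (FPsi.ket 0)) v

/-- `w` is a (not necessarily normalized) Glauber coherent state: a nonzero multiple of
`exp(α · a†)|0⟩` for some `α ∈ ℂᵇ`. -/
def IsCoherentState {b : ℕ} (w : FPsi b) : Prop :=
  ∃ (α : Fin b → ℂ) (c : ℂ) (v : FPsi b), c ≠ 0 ∧ IsExpVacuum α v ∧ w = c • v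

end Fock

end

/-!
# Invertible creators and coherent states

A creator is a left multiplication, so it is bijective exactly when the state is a unit of the ring.

*Fermions do not matter.* The kernel of `vacuumComponent`, a ring homomorphism, consists of nilpotent
elements, because products of more than `dim Hf` fermions vanish. A boson–fermion state is therefore
the central element `u₀ ⊗ 1` plus a nilpotent one (`isUnit_iff_isUnit_vacuumComponent`).

*Units of `F_ψ`.* In terms of the series `F(z) = ∑ₙ (⟨n|f⟩ / √n!) zⁿ`, membership in `F_ψ` makes the
restriction of `F` to each complex line `t ↦ F(tw)` an entire function of order two and type zero:
`|F(tw)| ≤ C_ε exp(ε |t|²)` for every `ε > 0` (`FPsi.orderTwoTypeZero_eval`). If `f` is a unit, this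
function has no zeros, so its logarithm is entire with real part at most `ε |t|² + O_ε(1)`; by
Borel–Carathéodory and Cauchy's estimates the logarithm is affine
(`Complex.eq_mul_exp_of_norm_le_exp_sq`). Hence `F(tw) = c exp(β(w) t)`. Comparing the terms of degree
one in `t` shows that `β(w) = α · w` is linear in `w`, and comparing those of degree `m`, for all `w`,
identifies the homogeneous part of degree `m` of `F` with `c (α · z)ᵐ / m!`. These are also the terms
of the series of `c exp(α · a†)|0⟩`. That series converges to `f` in `F_ψ`, because an element of
`F_ψ` is the sum of its components with a fixed number of bosons
(`hasSum_iff_of_comp_eq_zero`, `isExpVacuum_iff`).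

Conversely the series of `exp(α · a†)|0⟩` has the inverse obtained from `z ↦ -z`. This substitution
multiplies components by signs, so it preserves `F_ψ` (`parityFlip`, `IsExpVacuum.isUnit`).
-/

/-! ### Zero-free entire functions of order two and type zero -/

section Entire

/-- The logarithm of `f` has real part `o(‖z‖²)`; by Borel–Carathéodory and Cauchy's estimate for
the second derivative it is affine. -/
theorem Complex.eq_mul_exp_of_norm_le_exp_sq {f : ℂ → ℂ} (hf : Differentiable ℂ f)
    (hne : ∀ z, f z ≠ 0)
    (hgrowth : ∀ ε : ℝ, 0 < ε → ∃ C : ℝ, ∀ z, ‖f z‖ ≤ C * Real.exp (ε * ‖z‖ ^ 2)) :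
    ∃ β : ℂ, ∀ z, f z = f 0 * Complex.exp (β * z) := by
  have hd : Differentiable ℂ (fun z => deriv f z / f z) := (hf.deriv).div hf hne
  obtain ⟨g, hg0, hg⟩ := hd.isExactOn_univ.with_val_at 0 0
  replace hg : ∀ z, HasDerivAt g (deriv f z / f z) z := fun z => hg z (Set.mem_univ z)
  have hgd : Differentiable ℂ g := fun z => (hg z).differentiableAt
  -- `f * exp (-g)` has derivative zero
  have hfg : ∀ z, f z = f 0 * Complex.exp (g z) := by
    have h0 : ∀ z, HasDerivAt (fun z => f z * Complex.exp (-g z)) 0 z := by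
      intro z
      have h := (hf z).hasDerivAt.mul ((hg z).neg.cexp)
      refine h.congr_deriv ?_
      have := hne z
      field_simp
      ring
    intro z
    have h := is_const_of_deriv_eq_zero (f := fun z => f z * Complex.exp (-g z))
      (fun z => (h0 z).differentiableAt) (fun z => (h0 z).deriv) z 0
    simp only [hg0, neg_zero, Complex.exp_zero, mul_one] at h
    rw [← h, mul_assoc, ← Complex.exp_add]
    simp
  have hf0 : 0 < ‖f 0‖ := norm_pos_iff.2 (hne 0)
  have hre : ∀ ε : ℝ, 0 < ε → ∃ K : ℝ, 0 < K ∧ ∀ z, (g z).re ≤ K + ε * ‖z‖ ^ 2 := by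
    intro ε hε
    obtain ⟨C, hC⟩ := hgrowth ε hε
    have hCpos : 0 < C := by
      have := (norm_pos_iff.2 (hne 0)).trans_le (hC 0)
      simpa using this
    refine ⟨|Real.log (C / ‖f 0‖)| + 1, by positivity, fun z => ?_⟩
    have h1 : Real.exp (g z).re ≤ (C / ‖f 0‖) * Real.exp (ε * ‖z‖ ^ 2) := by
      have h := hC z
      rw [hfg z, norm_mul, Complex.norm_exp] at h
      rw [div_mul_eq_mul_div, le_div_iff₀ hf0]
      linarith
    have h2 := Real.log_le_log (Real.exp_pos _) h1
    rw [Real.log_exp, Real.log_mul (by positivity) (Real.exp_pos _).ne', Real.log_exp] at h2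
    have := le_abs_self (Real.log (C / ‖f 0‖))
    linarith
  have hnorm : ∀ ε : ℝ, 0 < ε → ∃ K : ℝ, ∀ r : ℝ, 0 < r → ∀ z, ‖z‖ ≤ r →
      ‖g z‖ ≤ K + ε * r ^ 2 := by
    intro ε hε
    obtain ⟨K, hK, hKz⟩ := hre (ε / 8) (by positivity)
    refine ⟨2 * K, fun r hr z hz => ?_⟩
    have hB := Complex.borelCaratheodory_zero (f := g) (M := K + ε / 8 * (2 * r) ^ 2)
      (R := 2 * r) (z := z) (by positivity) hgd.differentiableOn
      (fun x hx => by
        refine (hKz x).trans ?_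
        have : ‖x‖ ≤ 2 * r := (mem_ball_zero_iff.1 hx).le
        gcongr)
      (by positivity) (by rw [mem_ball_zero_iff]; linarith) hg0
    refine hB.trans ?_
    rw [div_le_iff₀ (by linarith)]
    have h2 : 0 ≤ 2 * K + ε * r ^ 2 := by positivity
    nlinarith [norm_nonneg z]
  have hsecond : ∀ c, iteratedDeriv 2 g c = 0 := by
    intro c
    rw [← norm_le_zero_iff]
    refine le_of_forall_pos_le_add fun ε hε => ?_
    obtain ⟨K, hK⟩ := hnorm (ε / 16) (by positivity)
    -- a radius that dominates both `‖c‖` and the constant `K`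
    obtain ⟨r, hr1, hr2, hr3⟩ : ∃ r : ℝ, 1 ≤ r ∧ ‖c‖ ≤ r ∧ 4 * |K| / ε ≤ r :=
      ⟨max 1 (max ‖c‖ (4 * |K| / ε)), le_max_left _ _,
        (le_max_left _ _).trans (le_max_right _ _), (le_max_right _ _).trans (le_max_right _ _)⟩
    have hrpos : 0 < r := by linarith
    have hC := Complex.norm_iteratedDeriv_le_of_forall_mem_sphere_norm_le 2 hrpos
      (hgd.diffContOnCl (s := Metric.ball c r)) (C := K + ε / 16 * (2 * r) ^ 2)
      (fun z hz => hK (2 * r) (by positivity) z (by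
        have h1 : ‖z - c‖ = r := mem_sphere_iff_norm.1 hz
        have h2 : ‖z‖ ≤ ‖z - c‖ + ‖c‖ := norm_le_norm_sub_add z c
        linarith))
    refine hC.trans ?_
    rw [div_le_iff₀ (by positivity)]
    rw [div_le_iff₀ hε] at hr3
    have h3 : r * ε ≤ r ^ 2 * ε := by gcongr; exact le_self_pow₀ hr1 two_ne_zero
    have h4 := le_abs_self K
    norm_num
    nlinarith
  have hconst : ∀ z, deriv g z = deriv g 0 := by
    have hgd' : Differentiable ℂ (deriv g) := hgd.deriv
    refine fun z => is_const_of_deriv_eq_zero hgd' (fun c => ?_) z 0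
    have := hsecond c
    rwa [iteratedDeriv_succ, iteratedDeriv_one] at this
  refine ⟨deriv g 0, fun z => ?_⟩
  have hlin : ∀ z, HasDerivAt (fun z => g z - deriv g 0 * z) 0 z := by
    intro z
    have h := (hgd z).hasDerivAt.sub ((hasDerivAt_id z).const_mul (deriv g 0))
    refine h.congr_deriv ?_
    rw [hconst z]
    simp
  have h := is_const_of_deriv_eq_zero (fun z => (hlin z).differentiableAt)
    (fun z => (hlin z).deriv) z 0
  simp only [hg0, mul_zero, sub_zero] at h
  rw [hfg z, sub_eq_zero.1 h]

end Entire

/-! ### Taylor coefficients and growth -/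

section PowerSeries

/-- The geometric factor makes the bound summable in `m`; it comes from applying
`yᵐ / m! ≤ exp y` to `y = (2x)²`. -/
theorem pow_div_sqrt_factorial_le {x : ℝ} (_ : 0 ≤ x) (m : ℕ) :
    x ^ m / √(m ! : ℝ) ≤ Real.exp (2 * x ^ 2) * (1 / 2) ^ m := by
  have h1 : (2 * x) ^ m / √(m ! : ℝ) ≤ Real.exp (2 * x ^ 2) := by
    refine le_of_sq_le_sq ?_ (Real.exp_pos _).le
    rw [div_pow, Real.sq_sqrt (by positivity), ← Real.exp_nat_mul, ← pow_mul, mul_comm m 2,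
      pow_mul]
    refine (Real.pow_div_factorial_le_exp _ (by positivity) m).trans (le_of_eq ?_)
    congr 1
    push_cast
    ring
  have h2 : x ^ m / √(m ! : ℝ) = ((2 * x) ^ m / √(m ! : ℝ)) * (1 / 2) ^ m := by
    rw [div_mul_eq_mul_div, ← mul_pow]
    congr 2
    ring
  rw [h2]
  gcongr

/-- The sequence `a` satisfies `‖a m‖ ≤ C_δ δᵐ / √m!` for every `δ > 0`. Equivalently, `∑ a m zᵐ` is
an entire function of growth at most order two and type zero. -/
def OrderTwoTypeZero (a : ℕ → ℂ) : Prop :=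
  ∀ δ : ℝ, 0 < δ → ∃ C : ℝ, 0 ≤ C ∧ ∀ m, ‖a m‖ ≤ C * (δ ^ m / √(m ! : ℝ))

theorem OrderTwoTypeZero.norm_mul_pow_le {a : ℕ → ℂ} (ha : OrderTwoTypeZero a) {ε : ℝ}
    (hε : 0 < ε) : ∃ C : ℝ, 0 ≤ C ∧ ∀ (z : ℂ) (m : ℕ),
      ‖a m * z ^ m‖ ≤ C * Real.exp (ε * ‖z‖ ^ 2) * (1 / 2) ^ m := by
  -- with `δ = √(ε / 2)`, the exponent `2 (δ ‖z‖)²` below equals `ε ‖z‖²`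
  obtain ⟨C, hC0, hC⟩ := ha (√(ε / 2)) (by positivity)
  refine ⟨C, hC0, fun z m => ?_⟩
  have h := pow_div_sqrt_factorial_le (x := √(ε / 2) * ‖z‖) (by positivity) m
  rw [mul_pow (√(ε / 2)) ‖z‖ 2, Real.sq_sqrt (by positivity), ← mul_assoc,
    mul_div_cancel₀ _ (two_ne_zero)] at h
  calc ‖a m * z ^ m‖ = ‖a m‖ * ‖z‖ ^ m := by rw [norm_mul, norm_pow]
    _ ≤ C * (√(ε / 2) ^ m / √(m ! : ℝ)) * ‖z‖ ^ m := by gcongr; exact hC m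
    _ = C * ((√(ε / 2) * ‖z‖) ^ m / √(m ! : ℝ)) := by rw [mul_pow]; ring
    _ ≤ C * (Real.exp (ε * ‖z‖ ^ 2) * (1 / 2) ^ m) := by gcongr
    _ = _ := by ring

theorem OrderTwoTypeZero.summable_norm {a : ℕ → ℂ} (ha : OrderTwoTypeZero a) (z : ℂ) :
    Summable fun m => ‖a m * z ^ m‖ := by
  obtain ⟨C, -, hC⟩ := ha.norm_mul_pow_le one_pos
  exact Summable.of_nonneg_of_le (fun _ => norm_nonneg _) (hC z)
    (summable_geometric_two.mul_left _)

theorem OrderTwoTypeZero.norm_tsum_le {a : ℕ → ℂ} (ha : OrderTwoTypeZero a) {ε : ℝ}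
    (hε : 0 < ε) : ∃ C : ℝ, ∀ z : ℂ, ‖∑' m, a m * z ^ m‖ ≤ C * Real.exp (ε * ‖z‖ ^ 2) := by
  obtain ⟨C, -, hC⟩ := ha.norm_mul_pow_le hε
  refine ⟨C * 2, fun z => ?_⟩
  refine (tsum_of_norm_bounded (summable_geometric_two.hasSum.mul_left _) (hC z)).trans ?_
  rw [tsum_geometric_two]
  exact le_of_eq (by ring)

theorem OrderTwoTypeZero.hasFPowerSeriesOnBall {a : ℕ → ℂ} (ha : OrderTwoTypeZero a) :
    HasFPowerSeriesOnBall (fun z => ∑' m, a m * z ^ m) (FormalMultilinearSeries.ofScalars ℂ a)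
      0 ⊤ where
  r_le := by
    refine le_of_eq (Eq.symm ?_)
    refine FormalMultilinearSeries.radius_eq_top_of_summable_norm _ fun r => ?_
    refine (ha.summable_norm (r : ℂ)).congr fun m => ?_
    rw [FormalMultilinearSeries.ofScalars_norm]
    simp
  r_pos := by simp
  hasSum := by
    intro y _
    simp only [FormalMultilinearSeries.ofScalars_apply_eq, zero_add, smul_eq_mul]
    exact (ha.summable_norm y).of_norm.hasSum

theorem OrderTwoTypeZero.differentiable {a : ℕ → ℂ} (ha : OrderTwoTypeZero a) :
    Differentiable ℂ (fun z => ∑' m, a m * z ^ m) := by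
  intro z
  exact (ha.hasFPowerSeriesOnBall.differentiableOn z (by simp)).differentiableAt (by simp)

/-- If the Cauchy product of two such sequences is `1`, both entire functions are zero-free, so the
coefficients are those of a multiple of an exponential. -/
theorem OrderTwoTypeZero.coeff_of_mul_eq_one {a a' : ℕ → ℂ} (ha : OrderTwoTypeZero a)
    (ha' : OrderTwoTypeZero a')
    (hmul : ∀ n, ∑ p ∈ Finset.HasAntidiagonal.antidiagonal n, a p.1 * a' p.2 =
      if n = 0 then 1 else 0) :
    ∃ β : ℂ, ∀ m, a m = a 0 * (β ^ m / m !) := by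
  have hzero : ∑' m, a m * (0 : ℂ) ^ m = a 0 := by
    rw [tsum_eq_single 0 (fun m hm => by simp [hm])]
    simp
  have hprod : ∀ z : ℂ, (∑' m, a m * z ^ m) * (∑' m, a' m * z ^ m) = 1 := by
    intro z
    rw [tsum_mul_tsum_eq_tsum_sum_antidiagonal_of_summable_norm (ha.summable_norm z)
      (ha'.summable_norm z)]
    have hterm : ∀ n, ∑ p ∈ Finset.HasAntidiagonal.antidiagonal n,
        a p.1 * z ^ p.1 * (a' p.2 * z ^ p.2) = if n = 0 then 1 else 0 := by
      intro n
      have h : ∀ p ∈ Finset.HasAntidiagonal.antidiagonal n, a p.1 * z ^ p.1 * (a' p.2 * z ^ p.2)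
          = (a p.1 * a' p.2) * z ^ n := by
        intro p hp
        rw [← Finset.HasAntidiagonal.mem_antidiagonal.1 hp, pow_add]
        ring
      rw [Finset.sum_congr rfl h, ← Finset.sum_mul, hmul]
      split_ifs with hn <;> simp [hn]
    simp_rw [hterm]
    exact tsum_ite_eq 0 _
  obtain ⟨β, hβ⟩ := Complex.eq_mul_exp_of_norm_le_exp_sq ha.differentiable
    (fun z hz => by simpa [hz] using hprod z) (fun ε hε => ha.norm_tsum_le hε)
  simp only [hzero] at hβ
  refine ⟨β, fun m => ?_⟩
  have h1 := ha.hasFPowerSeriesOnBall.hasFPowerSeriesAt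
  have h2 : HasFPowerSeriesAt (fun z => ∑' m, a m * z ^ m)
      (FormalMultilinearSeries.ofScalars ℂ fun m => a 0 * (β ^ m / m !)) 0 := by
    rw [hasFPowerSeriesAt_iff]
    refine Filter.Eventually.of_forall fun z => ?_
    rw [zero_add, hβ z, Complex.exp_eq_exp_ℂ]
    have hfun : (fun n => z ^ n • (FormalMultilinearSeries.ofScalars ℂ
        fun m => a 0 * (β ^ m / m !)).coeff n) = fun n : ℕ => a 0 * ((β * z) ^ n / n !) := by
      funext n
      rw [FormalMultilinearSeries.coeff_ofScalars, smul_eq_mul, mul_pow]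
      ring
    rw [hfun]
    exact (NormedSpace.expSeries_div_hasSum_exp (β * z)).mul_left (a 0)
  have h := congrArg (fun p => p.coeff m) (h1.eq_formalMultilinearSeries h2)
  simpa [FormalMultilinearSeries.coeff_ofScalars] using h

end PowerSeries

namespace Fock

/-! ### Nilpotency of states without fermion vacuum component -/

section Fermions

variable {M : Type*} [AddCommGroup M] [Module ℂ M]

/-- The elements of the exterior algebra all of whose homogeneous components have degree at
least `n`. -/
def fermionFiltration (M : Type*) [AddCommGroup M] [Module ℂ M] (n : ℕ) :
    Submodule ℂ (ExteriorAlgebra ℂ M) :=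
  ⨆ j, LinearMap.range (ExteriorAlgebra.ι ℂ : M →ₗ[ℂ] _) ^ (n + j)

theorem fermionFiltration_mul_le (m n : ℕ) :
    fermionFiltration M m * fermionFiltration M n ≤ fermionFiltration M (m + n) := by
  unfold fermionFiltration
  rw [Submodule.iSup_mul]
  refine iSup_le fun i => ?_
  rw [Submodule.mul_iSup]
  refine iSup_le fun j => ?_
  rw [← pow_add]
  refine le_iSup_of_le (i + j) (le_of_eq ?_)
  congr 1
  ring

theorem fermionFiltration_eq_bot [FiniteDimensional ℂ M] {n : ℕ} (hn : Module.finrank ℂ M < n) :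
    fermionFiltration M n = ⊥ := by
  refine iSup_eq_bot.2 fun j => ?_
  change (⋀[ℂ]^(n + j) M) = ⊥
  rw [← Submodule.finrank_eq_zero (R := ℂ), exteriorPower.finrank_eq]
  exact Nat.choose_eq_zero_of_lt (by omega)

theorem sub_algebraMapInv_mem (x : ExteriorAlgebra ℂ M) :
    x - algebraMap ℂ _ (ExteriorAlgebra.algebraMapInv x) ∈ fermionFiltration M 1 := by
  induction x using ExteriorAlgebra.induction with
  | algebraMap r => simp
  | ι m =>
    have h : ExteriorAlgebra.algebraMapInv (ExteriorAlgebra.ι ℂ m) = (0 : ℂ) := by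
      simp [ExteriorAlgebra.algebraMapInv]
    rw [h, map_zero, sub_zero]
    refine Submodule.mem_iSup_of_mem 0 ?_
    rw [add_zero, pow_one]
    exact ⟨m, rfl⟩
  | mul x y hx hy =>
    have h2 : fermionFiltration M (1 + 1) ≤ fermionFiltration M 1 :=
      iSup_le fun j => le_iSup_of_le (1 + j) (by rw [← add_assoc])
    have hxy := h2 (fermionFiltration_mul_le 1 1 (Submodule.mul_mem_mul hx hy))
    have h3 := Submodule.smul_mem _ (ExteriorAlgebra.algebraMapInv x) hy
    have h4 := Submodule.smul_mem _ (ExteriorAlgebra.algebraMapInv y) hx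
    convert add_mem (add_mem hxy h3) h4 using 1
    simp only [map_mul, Algebra.smul_def]
    have := Algebra.commutes (ExteriorAlgebra.algebraMapInv y) x
    simp only [mul_sub, sub_mul]
    rw [this, Algebra.commutes (ExteriorAlgebra.algebraMapInv y)
      (algebraMap ℂ (ExteriorAlgebra ℂ M) (ExteriorAlgebra.algebraMapInv x))]
    abel
  | add x y hx hy =>
    convert add_mem hx hy using 1
    simp only [map_add]
    abel

variable {B : Type*} [CommRing B] [Algebra ℂ B]

/-- The span in `B ⊗ ⋀ M` of the tensors whose fermion factor has degree at least `n`. -/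
def tensorFiltration (B M : Type*) [CommRing B] [Algebra ℂ B] [AddCommGroup M] [Module ℂ M]
    (n : ℕ) : Submodule ℂ (B ⊗[ℂ] ExteriorAlgebra ℂ M) :=
  Submodule.span ℂ {z | ∃ w : B, ∃ x ∈ fermionFiltration M n, z = w ⊗ₜ x}

theorem tensorFiltration_mul_le (m n : ℕ) :
    tensorFiltration B M m * tensorFiltration B M n ≤ tensorFiltration B M (m + n) := by
  unfold tensorFiltration
  rw [Submodule.span_mul_span]
  refine Submodule.span_mono ?_
  rintro _ ⟨_, ⟨w, x, hx, rfl⟩, _, ⟨w', x', hx', rfl⟩, rfl⟩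
  exact ⟨w * w', x * x', fermionFiltration_mul_le m n (Submodule.mul_mem_mul hx hx'),
    by simp⟩

theorem isNilpotent_of_mem_tensorFiltration [FiniteDimensional ℂ M]
    {z : B ⊗[ℂ] ExteriorAlgebra ℂ M} (hz : z ∈ tensorFiltration B M 1) : IsNilpotent z := by
  have hpow : ∀ n : ℕ, z ^ (n + 1) ∈ tensorFiltration B M (n + 1) := by
    intro n
    induction n with
    | zero => simpa using hz
    | succ n ih =>
      rw [pow_succ]
      exact tensorFiltration_mul_le _ _ (Submodule.mul_mem_mul ih hz)
  refine ⟨Module.finrank ℂ M + 1, ?_⟩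
  have h := hpow (Module.finrank ℂ M)
  have hbot : tensorFiltration B M (Module.finrank ℂ M + 1) = ⊥ := by
    rw [tensorFiltration, fermionFiltration_eq_bot (Nat.lt_succ_self _), Submodule.span_eq_bot]
    rintro _ ⟨w, x, hx, rfl⟩
    rw [(Submodule.mem_bot ℂ).1 hx, TensorProduct.tmul_zero]
  rwa [hbot, Submodule.mem_bot] at h

end Fermions

/-! ### Units and the fermion vacuum component -/

theorem bijective_creator_iff {A : Type*} [Ring A] [Algebra ℂ A] (u : A) :
    Function.Bijective (creator u : A →ₗ[ℂ] A) ↔ IsUnit u :=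
  IsUnit.isUnit_iff_mulLeft_bijective.symm

section VacuumComponent

variable {b : ℕ} {Hf : Type*} [NormedAddCommGroup Hf] [InnerProductSpace ℂ Hf]

theorem vacuumComponent_tmul (w : FPsi b) (x : FermionFock Hf) :
    vacuumComponent (w ⊗ₜ[ℂ] x) = (ExteriorAlgebra.algebraMapInv x : ℂ) • w := by
  simp [vacuumComponent]

theorem vacuumComponent_one : vacuumComponent (1 : BosonFermion b Hf) = 1 := by
  rw [Algebra.TensorProduct.one_def, vacuumComponent_tmul, map_one, one_smul]

theorem vacuumComponent_mul (u v : BosonFermion b Hf) :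
    vacuumComponent (u * v) = vacuumComponent u * vacuumComponent v := by
  induction u using TensorProduct.induction_on with
  | zero => simp
  | add u u' hu hu' => rw [add_mul, map_add, map_add, hu, hu', add_mul]
  | tmul w x =>
    induction v using TensorProduct.induction_on with
    | zero => simp
    | add v v' hv hv' => rw [mul_add, map_add, map_add, hv, hv', mul_add]
    | tmul w' x' =>
      rw [Algebra.TensorProduct.tmul_mul_tmul, vacuumComponent_tmul, vacuumComponent_tmul,
        vacuumComponent_tmul, map_mul, smul_mul_smul_comm]

theorem sub_vacuumComponent_mem (u : BosonFermion b Hf) :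
    u - vacuumComponent u ⊗ₜ[ℂ] 1 ∈ tensorFiltration (FPsi b) Hf 1 := by
  induction u using TensorProduct.induction_on with
  | zero => simp
  | add u v hu hv =>
    rw [map_add, TensorProduct.add_tmul, add_sub_add_comm]
    exact add_mem hu hv
  | tmul w x =>
    rw [vacuumComponent_tmul, TensorProduct.smul_tmul, ← TensorProduct.tmul_sub,
      ← Algebra.algebraMap_eq_smul_one]
    exact Submodule.subset_span ⟨w, _, sub_algebraMapInv_mem x, rfl⟩

/-- A boson–fermion state differs from `u₀ ⊗ 1` by a nilpotent element, and `u₀ ⊗ 1` is central,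
so only the fermion vacuum component decides invertibility. -/
theorem isUnit_iff_isUnit_vacuumComponent [FiniteDimensional ℂ Hf] (u : BosonFermion b Hf) :
    IsUnit u ↔ IsUnit (vacuumComponent u) := by
  constructor
  · intro h
    exact h.map (⟨⟨vacuumComponent, vacuumComponent_one⟩, vacuumComponent_mul⟩ :
      BosonFermion b Hf →* FPsi b)
  · intro h
    have hnil := isNilpotent_of_mem_tensorFiltration (sub_vacuumComponent_mem u)
    have hunit : IsUnit (vacuumComponent u ⊗ₜ[ℂ] (1 : FermionFock Hf)) :=
      h.map (Algebra.TensorProduct.includeLeft : FPsi b →ₐ[ℂ] BosonFermion b Hf)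
    have hcomm : ∀ z : BosonFermion b Hf,
        Commute z (vacuumComponent u ⊗ₜ[ℂ] (1 : FermionFock Hf)) := by
      intro z
      induction z using TensorProduct.induction_on with
      | zero => exact Commute.zero_left _
      | add z z' hz hz' => exact hz.add_left hz'
      | tmul w x => simp [Commute, SemiconjBy, mul_comm]
    have := hnil.isUnit_add_left_of_commute hunit (hcomm _)
    simpa using this

end VacuumComponent


/-! ### Homogeneous parts of power series -/

section HomogeneousParts

variable {b : ℕ}

/-- The homogeneous part of degree `m` of a power series, as a polynomial. -/
noncomputable def homPart (m : ℕ) (F : MvPowerSeries (Fin b) ℂ) : MvPolynomial (Fin b) ℂ :=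
  ∑ n ∈ Finset.finsuppAntidiag Finset.univ m, MvPolynomial.monomial n (MvPowerSeries.coeff n F)

theorem mem_finsuppAntidiag_univ {m : ℕ} {n : Fin b →₀ ℕ} :
    n ∈ Finset.finsuppAntidiag Finset.univ m ↔ n.degree = m := by
  simp [Finset.mem_finsuppAntidiag, Finsupp.degree_eq_sum]

theorem coeff_homPart (m : ℕ) (F : MvPowerSeries (Fin b) ℂ) (n : Fin b →₀ ℕ) :
    (homPart m F).coeff n = if n.degree = m then MvPowerSeries.coeff n F else 0 := by
  classical
  simp only [homPart, MvPolynomial.coeff_sum, MvPolynomial.coeff_monomial,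
    Finset.sum_ite_eq', mem_finsuppAntidiag_univ]

theorem homPart_one (m : ℕ) :
    homPart m (1 : MvPowerSeries (Fin b) ℂ) = if m = 0 then 1 else 0 := by
  classical
  ext n
  rw [coeff_homPart, MvPowerSeries.coeff_one]
  by_cases hn : n = 0
  · subst hn
    by_cases hm : m = 0 <;> simp [hm, eq_comm]
  · by_cases hm : m = 0 <;> simp [hm, hn, MvPolynomial.coeff_one, eq_comm]

theorem homPart_mul (m : ℕ) (F G : MvPowerSeries (Fin b) ℂ) :
    homPart m (F * G) =
      ∑ p ∈ Finset.HasAntidiagonal.antidiagonal m, homPart p.1 F * homPart p.2 G := by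
  classical
  ext n
  simp only [coeff_homPart, MvPowerSeries.coeff_mul, MvPolynomial.coeff_sum,
    MvPolynomial.coeff_mul]
  rw [Finset.sum_comm]
  have key : ∀ x ∈ Finset.HasAntidiagonal.antidiagonal n,
      ∑ p ∈ Finset.HasAntidiagonal.antidiagonal m,
        ((if x.1.degree = p.1 then MvPowerSeries.coeff x.1 F else 0) *
          (if x.2.degree = p.2 then MvPowerSeries.coeff x.2 G else 0)) =
      if n.degree = m then MvPowerSeries.coeff x.1 F * MvPowerSeries.coeff x.2 G else 0 := by
    intro x hx
    have hdeg : x.1.degree + x.2.degree = n.degree := by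
      rw [← Finset.HasAntidiagonal.mem_antidiagonal.1 hx, map_add]
    split_ifs with hn
    · rw [Finset.sum_eq_single (x.1.degree, x.2.degree)]
      · simp
      · rintro ⟨i, j⟩ - hne
        by_cases h1 : x.1.degree = i
        · have h2 : x.2.degree ≠ j := fun h2 => hne (by rw [h1, h2])
          simp [h2]
        · simp [h1]
      · intro h
        exact absurd (Finset.HasAntidiagonal.mem_antidiagonal.2 (hdeg.trans hn)) h
    · refine Finset.sum_eq_zero fun p hp => ?_
      rw [Finset.HasAntidiagonal.mem_antidiagonal] at hp
      by_cases h1 : x.1.degree = p.1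
      · have h2 : x.2.degree ≠ p.2 := fun h2 => hn (by rw [← hdeg, h1, h2, hp])
        simp [h2]
      · simp [h1]
  rw [Finset.sum_congr rfl key]
  split_ifs <;> simp

theorem eval_homPart (m : ℕ) (F : MvPowerSeries (Fin b) ℂ) (w : Fin b → ℂ) :
    MvPolynomial.eval w (homPart m F) =
      ∑ n ∈ Finset.finsuppAntidiag Finset.univ m, MvPowerSeries.coeff n F * ∏ i, w i ^ n i := by
  simp only [homPart, map_sum, MvPolynomial.eval_monomial]
  refine Finset.sum_congr rfl fun n _ => ?_
  rw [Finsupp.prod_fintype _ _ fun i => pow_zero _]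

theorem sum_pow_eq_sum_finsuppAntidiag (s : Fin b → ℝ) (m : ℕ) :
    (∑ i, s i) ^ m = ∑ n ∈ Finset.finsuppAntidiag Finset.univ m,
      (Nat.multinomial Finset.univ n : ℝ) * ∏ i, s i ^ n i := by
  rw [Finset.sum_pow_eq_sum_piAntidiag]
  refine Finset.sum_nbij' (fun n => Finsupp.equivFunOnFinite.symm n) (fun n => n) ?_ ?_ ?_ ?_ ?_
  · intro n hn
    simpa [Finset.mem_finsuppAntidiag, Finset.mem_piAntidiag] using hn
  · intro n hn
    simpa [Finset.mem_finsuppAntidiag, Finset.mem_piAntidiag] using hn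
  · intro n _
    rfl
  · intro n _
    ext
    rfl
  · intro n _
    rfl

/-- Bounds `1 / √n!` by a multinomial coefficient over `√|n|!`, which makes the multinomial theorem
applicable to sums weighted with `1 / √n!`. -/
theorem sqrt_factorial_degree_le (n : Fin b →₀ ℕ) :
    √(n.degree ! : ℝ) ≤ Nat.multinomial Finset.univ n * √(multiFactorial n : ℝ) := by
  rw [Real.sqrt_le_left (by positivity), mul_pow, Real.sq_sqrt (by positivity),
    Finsupp.degree_eq_sum]
  have h := Nat.multinomial_spec Finset.univ n
  have hpos : 1 ≤ Nat.multinomial Finset.univ n := Nat.multinomial_pos _ _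
  have h2 : (∑ i, n i)! ≤ Nat.multinomial Finset.univ n ^ 2 * multiFactorial n := by
    rw [← h, mul_comm]
    exact Nat.mul_le_mul_right _ (Nat.le_self_pow two_ne_zero _)
  exact_mod_cast h2

end HomogeneousParts

/-! ### Growth of the series of a state along complex lines -/

namespace FPsi

variable {b : ℕ}

theorem norm_comp_le (f : FPsi b) (k : ℕ+) (n : Fin b →₀ ℕ) :
    ‖f.comp n‖ ≤ ‖toHilbert k f‖ * ((k : ℝ)⁻¹) ^ n.degree := by
  have h := lp.norm_apply_le_norm two_ne_zero (toHilbert k f) n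
  have h2 : ‖(toHilbert k f : HilbertFock b) n‖ = (k : ℝ) ^ n.degree * ‖f.comp n‖ := by
    change ‖((k : ℕ) : ℂ) ^ n.degree * f.comp n‖ = _
    simp
  rw [h2] at h
  have hk : (0 : ℝ) < k := by exact_mod_cast k.pos
  rw [inv_pow, ← div_eq_mul_inv, le_div_iff₀ (by positivity)]
  linarith

/-- The restriction of the series of a state in `F_ψ` to a complex line has order two and type
zero: `∑_{|n| = m} |wⁿ| / √n! ≤ (∑ᵢ |wᵢ|)ᵐ / √m!` by the multinomial theorem. -/
theorem orderTwoTypeZero_eval (f : FPsi b) (w : Fin b → ℂ) :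
    OrderTwoTypeZero fun m => MvPolynomial.eval w (homPart m (toSeries f)) := by
  intro δ hδ
  -- `|⟨n|f⟩| ≤ ‖f‖_k k^(-|n|)`, so it is enough that `∑ᵢ ‖wᵢ‖ / k ≤ δ`
  obtain ⟨k, hk⟩ := exists_nat_gt ((∑ i, ‖w i‖) / δ)
  have hk0 : 0 < k := by
    have : (0 : ℝ) < k := lt_of_le_of_lt (by positivity) hk
    exact_mod_cast this
  set K : ℕ+ := ⟨k, hk0⟩
  refine ⟨‖toHilbert K f‖, norm_nonneg _, fun m => ?_⟩
  have hle : (k : ℝ)⁻¹ * ∑ i, ‖w i‖ ≤ δ := by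
    rw [div_lt_iff₀ hδ] at hk
    rw [inv_mul_le_iff₀ (by exact_mod_cast hk0)]
    exact hk.le
  have hterm : ∀ n ∈ Finset.finsuppAntidiag (Finset.univ : Finset (Fin b)) m,
      ‖MvPowerSeries.coeff n (toSeries f) * ∏ i, w i ^ n i‖ ≤
        ‖toHilbert K f‖ * (k : ℝ)⁻¹ ^ m / √(m ! : ℝ) *
          ((Nat.multinomial Finset.univ n : ℝ) * ∏ i, ‖w i‖ ^ n i) := by
    intro n hn
    rw [mem_finsuppAntidiag_univ] at hn
    have h1 := norm_comp_le f K n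
    have h2 := sqrt_factorial_degree_le n
    rw [hn] at h1 h2
    have h3 : (0 : ℝ) < √(multiFactorial n : ℝ) :=
      Real.sqrt_pos.2 (by exact_mod_cast multiFactorial_pos n)
    have h4 : (0 : ℝ) < √(m ! : ℝ) := Real.sqrt_pos.2 (by exact_mod_cast Nat.factorial_pos m)
    rw [norm_mul, norm_prod, coeff_toSeries, norm_div, Complex.norm_real, Real.norm_eq_abs,
      abs_of_pos h3, ← mul_assoc]
    simp only [norm_pow]
    refine mul_le_mul_of_nonneg_right ?_ (by positivity)
    rw [div_mul_eq_mul_div, div_le_div_iff₀ h3 h4]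
    calc _ ≤ (‖toHilbert K f‖ * (k : ℝ)⁻¹ ^ m) *
        (Nat.multinomial Finset.univ n * √(multiFactorial n : ℝ)) := by
          gcongr
          exact h1
      _ = _ := by ring
  simp only [eval_homPart]
  refine (norm_sum_le _ _).trans ((Finset.sum_le_sum hterm).trans ?_)
  rw [← Finset.mul_sum, ← sum_pow_eq_sum_finsuppAntidiag]
  calc _ = ‖toHilbert K f‖ * (((k : ℝ)⁻¹ * ∑ i, ‖w i‖) ^ m / √(m ! : ℝ)) := by
        rw [mul_pow]; ring
    _ ≤ _ := by gcongr

end FPsi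

/-! ### Coherent states -/

section Coherent

variable {b : ℕ}

open FPsi

/-- The linear form `∑ᵢ αᵢ zᵢ`. -/
noncomputable def linearForm (α : Fin b → ℂ) : MvPolynomial (Fin b) ℂ :=
  ∑ i, α i • MvPolynomial.X i

theorem coeff_linearForm_pow_of_degree_ne (α : Fin b → ℂ) {m : ℕ} {n : Fin b →₀ ℕ}
    (h : n.degree ≠ m) : ((linearForm α) ^ m).coeff n = 0 := by
  rw [linearForm, MvPolynomial.coeff_linearCombination_X_pow_of_fintype, if_neg]
  rwa [Finsupp.sum_fintype _ _ fun _ => rfl, ← Finsupp.degree_eq_sum]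

theorem toSeries_ket_single (i : Fin b) :
    toSeries (ket (Finsupp.single i 1)) = MvPowerSeries.X i := by
  classical
  ext n
  rw [coeff_toSeries, MvPowerSeries.coeff_X]
  change (Pi.single (Finsupp.single i 1) 1 : (Fin b →₀ ℕ) → ℂ) n / _ = _
  rcases eq_or_ne n (Finsupp.single i 1) with rfl | h
  · have : multiFactorial (Finsupp.single i 1) = 1 := by
      refine Finset.prod_eq_one fun j _ => ?_
      by_cases hij : i = j <;> simp [hij]
    simp [this]
  · simp [h]

/-- Acting with `α · a†` multiplies the series by the linear form `∑ᵢ αᵢ zᵢ`. -/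
theorem toSeries_linearCreation (α : Fin b → ℂ) (f : FPsi b) :
    toSeries (linearCreation α f) = (linearForm α : MvPowerSeries (Fin b) ℂ) * toSeries f := by
  have hsum : ∀ (s : Finset (Fin b)) (g : Fin b → FPsi b),
      toSeries (∑ i ∈ s, g i) = ∑ i ∈ s, toSeries (g i) := fun s g =>
    map_sum (⟨⟨toSeries, toSeries_zero⟩, toSeries_add⟩ : FPsi b →+ MvPowerSeries (Fin b) ℂ) g s
  have hcoe : (linearForm α : MvPowerSeries (Fin b) ℂ) = ∑ i, α i • MvPowerSeries.X i := by
    rw [linearForm, ← MvPolynomial.coeToMvPowerSeries.ringHom_apply, map_sum]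
    refine Finset.sum_congr rfl fun i _ => ?_
    rw [MvPolynomial.coeToMvPowerSeries.ringHom_apply, MvPolynomial.coe_smul,
      MvPolynomial.coe_X]
  rw [linearCreation, LinearMap.sum_apply, hsum, hcoe, Finset.sum_mul]
  refine Finset.sum_congr rfl fun i _ => ?_
  rw [LinearMap.smul_apply, toSeries_smul, smul_mul_assoc, ← toSeries_ket_single, ← toSeries_mul]
  rfl

theorem toSeries_linearCreation_pow (α : Fin b → ℂ) (m : ℕ) :
    toSeries ((linearCreation α ^ m) (ket 0)) =
      ((linearForm α ^ m : MvPolynomial (Fin b) ℂ) : MvPowerSeries (Fin b) ℂ) := by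
  induction m with
  | zero =>
    rw [pow_zero, pow_zero, MvPolynomial.coe_one]
    exact toSeries_one
  | succ m ih =>
    rw [pow_succ', Module.End.mul_apply, toSeries_linearCreation, ih, pow_succ',
      MvPolynomial.coe_mul]

theorem continuous_comp (n : Fin b →₀ ℕ) : Continuous fun f : FPsi b => f.comp n := by
  have h1 : Continuous (toHilbert (b := b) 1) :=
    continuous_iInf_dom (i := (1 : ℕ+)) continuous_induced_dom
  have h2 : Continuous fun f : HilbertFock b => f n :=
    (lp.lipschitzWith_one_eval 2 n).continuous
  convert h2.comp h1 using 2 with f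
  change _ = ((1 : ℕ+) : ℂ) ^ n.degree * f.comp n
  simp

theorem hasSum_of_toHilbert {ι : Type*} {u : ι → FPsi b} {v : FPsi b}
    (h : ∀ k : ℕ+, HasSum (fun m => toHilbert k (u m)) (toHilbert k v)) : HasSum u v := by
  unfold HasSum
  rw [nhds_iInf, Filter.tendsto_iInf]
  intro k
  rw [nhds_induced, Filter.tendsto_comap_iff]
  have hadd : ∀ f g : FPsi b, toHilbert k (f + g) = toHilbert k f + toHilbert k g := by
    intro f g
    ext n
    exact mul_add _ _ _
  have hzero : toHilbert k (0 : FPsi b) = 0 := by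
    ext n
    exact mul_zero _
  have hsum : toHilbert k ∘ (fun s : Finset ι => ∑ i ∈ s, u i) =
      fun s => ∑ i ∈ s, toHilbert k (u i) := by
    funext s
    exact map_sum (⟨⟨toHilbert k, hzero⟩, hadd⟩ : FPsi b →+ HilbertFock b) u s
  rw [hsum]
  exact h k

/-- A series whose `m`-th term lies in the `m`-boson sector converges in `F_ψ` as soon as it
converges componentwise to an element of `F_ψ`. -/
theorem hasSum_iff_of_comp_eq_zero {u : ℕ → FPsi b} {v : FPsi b}
    (hu : ∀ m n, n.degree ≠ m → (u m).comp n = 0) :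
    HasSum u v ↔ ∀ n, v.comp n = (u n.degree).comp n := by
  constructor
  · intro h n
    have h1 := h.map (⟨⟨fun f : FPsi b => f.comp n, rfl⟩, fun f g => comp_add f g n⟩ :
      FPsi b →+ ℂ) (continuous_comp n)
    exact h1.unique (hasSum_single n.degree fun m hm => hu m n hm.symm)
  · intro h
    refine hasSum_of_toHilbert fun k => ?_
    -- expand in the occupation-number basis and group the kets by their number of bosons
    have h1 := lp.hasSum_single (p := 2) (by simp) (toHilbert k v)
    rw [← (Equiv.sigmaFiberEquiv (Finsupp.degree : (Fin b →₀ ℕ) → ℕ)).hasSum_iff] at h1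
    refine h1.sigma fun m => ?_
    have h2 := lp.hasSum_single (p := 2) (by simp) (toHilbert k (u m))
    have hsupp : Function.support (fun n => lp.single (E := fun _ : Fin b →₀ ℕ => ℂ) 2 n
        (toHilbert k (u m) n)) ⊆ {n | n.degree = m} := by
      intro n hn
      by_contra hne
      refine hn ?_
      have : (toHilbert k (u m) : HilbertFock b) n = 0 := by
        change _ * (u m).comp n = 0
        rw [hu m n hne, mul_zero]
      simp only [this, lp.single_zero]
    rw [← hasSum_subtype_iff_of_support_subset hsupp] at h2
    have h3 : HasSum (fun x : {n : Fin b →₀ ℕ // n.degree = m} =>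
        lp.single (E := fun _ : Fin b →₀ ℕ => ℂ) 2 x.1 (toHilbert k (u m) x.1))
        (toHilbert k (u m)) := h2
    convert h3 using 1
    funext ⟨n, hn⟩
    have hn' : n.degree = m := hn
    subst hn'
    simp only [Function.comp, Equiv.sigmaFiberEquiv_apply]
    congr 1
    change _ * v.comp n = _ * (u _).comp n
    rw [h n]

/-- The vector `v` is `exp(α · a†)|0⟩` exactly when the homogeneous parts of its series are
`(α · z)ᵐ / m!`; the convergence in `F_ψ` is then automatic. -/
theorem isExpVacuum_iff (α : Fin b → ℂ) (v : FPsi b) :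
    IsExpVacuum α v ↔ ∀ m, homPart m (toSeries v) = (m ! : ℂ)⁻¹ • linearForm α ^ m := by
  have hcomp : ∀ m n, MvPowerSeries.coeff n
      (toSeries ((m ! : ℂ)⁻¹ • (linearCreation α ^ m) (ket 0))) =
      ((m ! : ℂ)⁻¹ • linearForm α ^ m).coeff n := by
    intro m n
    rw [toSeries_smul, toSeries_linearCreation_pow, MvPowerSeries.coeff_smul,
      MvPolynomial.coeff_coe, MvPolynomial.coeff_smul, smul_eq_mul]
  have hinj : ∀ (f g : FPsi b) (n : Fin b →₀ ℕ), f.comp n = g.comp n ↔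
      MvPowerSeries.coeff n (toSeries f) = MvPowerSeries.coeff n (toSeries g) := by
    intro f g n
    rw [coeff_toSeries, coeff_toSeries, div_left_inj' (sqrt_ne n)]
  have hzero : ∀ m n, n.degree ≠ m → ((m ! : ℂ)⁻¹ • linearForm α ^ m).coeff n = 0 := by
    intro m n h
    rw [MvPolynomial.coeff_smul, coeff_linearForm_pow_of_degree_ne α h, smul_zero]
  rw [IsExpVacuum, hasSum_iff_of_comp_eq_zero]
  · constructor
    · intro h m
      ext n
      rw [coeff_homPart]
      split_ifs with hn
      · subst hn
        rw [(hinj _ _ _).1 (h n), hcomp]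
      · rw [hzero m n hn]
    · intro h n
      rw [hinj, hcomp, ← h, coeff_homPart, if_pos rfl]
  · intro m n h
    have := hcomp m n
    rw [hzero m n h, coeff_toSeries, div_eq_zero_iff] at this
    exact this.resolve_right (sqrt_ne n)

/-- The state with components `(-1)^|n| ⟨n|f⟩`; it reflects the series, `F(z) ↦ F(-z)`. -/
noncomputable def parityFlip (f : FPsi b) : FPsi b :=
  ⟨fun n => (-1) ^ n.degree * f.comp n, fun k hk => by
    have h := (memℓp_rescale_iff k _).1 (f.2 k hk)
    rw [memℓp_rescale_iff]
    simpa [comp] using h⟩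

theorem homPart_parityFlip (f : FPsi b) (m : ℕ) :
    homPart m (toSeries (parityFlip f)) = (-1 : ℂ) ^ m • homPart m (toSeries f) := by
  ext n
  rw [MvPolynomial.coeff_smul, coeff_homPart, coeff_homPart]
  split_ifs with h
  · subst h
    rw [coeff_toSeries, coeff_toSeries, smul_eq_mul, ← mul_div_assoc]
    rfl
  · simp

theorem eq_of_homPart {F G : MvPowerSeries (Fin b) ℂ} (h : ∀ m, homPart m F = homPart m G) :
    F = G := by
  ext n
  simpa [coeff_homPart] using congrArg (MvPolynomial.coeff n) (h n.degree)

/-- The exponential `exp(α · z)` has the inverse `exp(-α · z)`, its reflection. -/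
theorem IsExpVacuum.isUnit {α : Fin b → ℂ} {v : FPsi b} (h : IsExpVacuum α v) : IsUnit v := by
  rw [isExpVacuum_iff] at h
  refine IsUnit.of_mul_eq_one (parityFlip v) (toSeries_injective (eq_of_homPart fun m => ?_))
  rw [toSeries_mul, toSeries_one, homPart_one, homPart_mul]
  have hbin := (Commute.all (linearForm α) (-linearForm α)).add_pow' m
  have hterm : ∀ p ∈ Finset.HasAntidiagonal.antidiagonal m,
      homPart p.1 (toSeries v) * homPart p.2 (toSeries (parityFlip v)) =
        (m ! : ℂ)⁻¹ • (m.choose p.1 • (linearForm α ^ p.1 * (-linearForm α) ^ p.2)) := by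
    rintro ⟨i, j⟩ hp
    rw [Finset.HasAntidiagonal.mem_antidiagonal] at hp
    simp only at hp ⊢
    subst hp
    rw [homPart_parityFlip, h, h, neg_pow (linearForm α),
      show (i + j).choose i = (i + j)! / (i ! * j !) by
        rw [Nat.choose_symm_add, Nat.add_choose],
      ← Nat.cast_smul_eq_nsmul ℂ, smul_smul,
      Nat.cast_div (Nat.factorial_mul_factorial_dvd_factorial_add i j)
        (by exact_mod_cast (mul_pos (Nat.factorial_pos i) (Nat.factorial_pos j)).ne')]
    have h1 : ((i + j)! : ℂ) ≠ 0 := by exact_mod_cast (Nat.factorial_pos _).ne'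
    have h2 : (i ! : ℂ) ≠ 0 := by exact_mod_cast (Nat.factorial_pos _).ne'
    have h3 : (j ! : ℂ) ≠ 0 := by exact_mod_cast (Nat.factorial_pos _).ne'
    have h4 : ((i + j)! : ℂ)⁻¹ * (((i + j)! : ℂ) / ((i ! * j ! : ℕ) : ℂ)) =
        (i ! : ℂ)⁻¹ * (j ! : ℂ)⁻¹ := by
      push_cast
      field_simp
    have h5 := congrArg (MvPolynomial.C (σ := Fin b)) h4
    simp only [MvPolynomial.smul_eq_C_mul, map_mul, map_pow, map_neg, map_one] at h5 ⊢
    linear_combination (-(linearForm α ^ i * ((-1) ^ j * linearForm α ^ j))) * h5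
  rw [Finset.sum_congr rfl hterm, ← Finset.smul_sum, ← hbin, add_neg_cancel]
  split_ifs with hm
  · simp [hm]
  · rw [zero_pow hm, smul_zero]

/-- On every complex line the series of an invertible state is a zero-free entire function of
order two and type zero, hence `c exp(β t)`; here `β` depends linearly on the direction because
it is read off from the part of degree one. -/
theorem isCoherentState_of_isUnit {f : FPsi b} (hf : IsUnit f) : IsCoherentState f := by
  obtain ⟨g, hfg⟩ := hf.exists_right_inv
  set A : ℕ → MvPolynomial (Fin b) ℂ := fun m => homPart m (toSeries f) with hA
  set c : ℂ := MvPowerSeries.coeff 0 (toSeries f) with hc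
  have hA0 : ∀ w, MvPolynomial.eval w (A 0) = c := by
    intro w
    rw [hA, eval_homPart]
    simp [hc]
  have hmul : ∀ (w : Fin b → ℂ) (m : ℕ), ∑ p ∈ Finset.HasAntidiagonal.antidiagonal m,
      MvPolynomial.eval w (A p.1) * MvPolynomial.eval w (homPart p.2 (toSeries g)) =
        if m = 0 then 1 else 0 := by
    intro w m
    simp only [hA, ← map_mul, ← map_sum]
    rw [← homPart_mul, ← toSeries_mul, hfg, toSeries_one, homPart_one]
    split_ifs <;> simp
  have hc0 : c ≠ 0 := by
    intro h
    have := hmul 0 0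
    rw [Finset.HasAntidiagonal.antidiagonal_zero] at this
    simp only [Prod.mk_zero_zero, Finset.sum_singleton, Prod.fst_zero, hA0, h, zero_mul,
      if_true, zero_ne_one] at this
  set α : Fin b → ℂ := fun i => c⁻¹ * MvPowerSeries.coeff (Finsupp.single i 1) (toSeries f)
    with hα
  have hA1 : A 1 = c • linearForm α := by
    classical
    ext n
    rw [hA, coeff_homPart, MvPolynomial.coeff_smul]
    split_ifs with hn
    · obtain ⟨i, rfl⟩ : ∃ i, n = Finsupp.single i 1 := by
        rw [Finsupp.degree_apply] at hn
        exact (Finsupp.sum_eq_one_iff n).1 hn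
      simp [linearForm, MvPolynomial.coeff_sum, MvPolynomial.coeff_X, hα, hc0,
        Finsupp.single_left_inj]
    · rw [← pow_one (linearForm α), coeff_linearForm_pow_of_degree_ne α hn, smul_zero]
  have hAm : ∀ m, A m = (c * (m ! : ℂ)⁻¹) • linearForm α ^ m := by
    intro m
    refine MvPolynomial.funext fun w => ?_
    obtain ⟨β, hβ⟩ := (orderTwoTypeZero_eval f w).coeff_of_mul_eq_one
      (orderTwoTypeZero_eval g w) (hmul w)
    have hβ' : ∀ m, MvPolynomial.eval w (A m) = c * (β ^ m / m !) := fun m => by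
      rw [← hA0 w]; exact hβ m
    have h1 := hβ' 1
    rw [hA1, MvPolynomial.smul_eval] at h1
    have hβeq : MvPolynomial.eval w (linearForm α) = β := by
      simpa [hc0] using h1
    rw [hβ' m, MvPolynomial.smul_eval, map_pow, hβeq]
    ring
  refine ⟨α, c, c⁻¹ • f, hc0, ?_, by rw [smul_smul, mul_inv_cancel₀ hc0, one_smul]⟩
  rw [isExpVacuum_iff]
  intro m
  have hsmul : homPart m (toSeries (c⁻¹ • f)) = c⁻¹ • A m := by
    ext n
    rw [MvPolynomial.coeff_smul, coeff_homPart, hA, coeff_homPart, toSeries_smul,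
      MvPowerSeries.coeff_smul]
    split_ifs <;> simp
  rw [hsmul, hAm, smul_smul, inv_mul_cancel_left₀ hc0]

theorem isUnit_iff_isCoherentState (f : FPsi b) : IsUnit f ↔ IsCoherentState f := by
  refine ⟨isCoherentState_of_isUnit, ?_⟩
  rintro ⟨α, c, v, hc, hv, rfl⟩
  rw [← Units.smul_mk0 hc]
  exact hv.isUnit.smul _

end Coherent

end Fock

/-- For a boson–fermion creator `U` (the creator of an arbitrary state `u ∈ E`), with boson block
`U₀`, the creator of the boson state `u₀` associated with the fermion vacuum: `U` is invertible iff
`U₀` is invertible iff `U₀|0⟩` is a coherent state. -/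
theorem theorem2 (b : ℕ) (Hf : Type*) [NormedAddCommGroup Hf] [InnerProductSpace ℂ Hf]
    [FiniteDimensional ℂ Hf] (u : Fock.BosonFermion b Hf) :
    List.TFAE [
      Function.Bijective (Fock.creator u : Fock.BosonFermion b Hf →ₗ[ℂ] Fock.BosonFermion b Hf),
      Function.Bijective
        (Fock.creator (Fock.vacuumComponent u) : Fock.FPsi b →ₗ[ℂ] Fock.FPsi b),
      Fock.IsCoherentState
        (Fock.creator (Fock.vacuumComponent u) (Fock.FPsi.ket 0 : Fock.FPsi b))] := by
  have h0 : Fock.creator (Fock.vacuumComponent u) (Fock.FPsi.ket 0 : Fock.FPsi b) =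
      Fock.vacuumComponent u := mul_one (Fock.vacuumComponent u)
  rw [h0, Fock.bijective_creator_iff, Fock.bijective_creator_iff,
    Fock.isUnit_iff_isUnit_vacuumComponent, ← Fock.isUnit_iff_isCoherentState]
  exact List.tfae_of_forall (IsUnit (Fock.vacuumComponent u)) _ (by simp)
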